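/- Let $\Omega=\{1,2\}^{\mathbb Z}$ with the pointwise order, the product topology and the Borel $\sigma$-algebra; sites of height $2$ are called critical. For a finite $A\subset\mathbb Z$ let $\eta_A\in\Omega$ be the configuration whose set of critical sites is $A$. For $i\in A$ put $k^+=\inf\{j\ge 0:\ i+j\notin A\}$, $k^-=\inf\{j>0:\ i-j\notin A\}$ and $T_iA=(A\setminus\{i+k^+-k^-\})\cup\{i+k^+,\,i-k^-\}$ (an avalanche); for $i\notin A$ put $T_iA=A\cup\{i\}$ (a birth). For $n\ge 0$ let $S_n(t)$ be the semigroup of the continuous-time Markov chain on finite subsets of $\mathbb Z$ that jumps with rate $1$ from $A$ to $T_iA$ for each $i\in A\cup([-n,n]\cap\mathbb Z)$ (avalanches everywhere, births in $[-n,n]$ only), and write $S_n(t)f(\eta_A)$ for the expectation of $f(\eta_{A(t)})$ when $A(0)=A$. For $\eta\in\Omega$ let $\eta^m$ be equal to $\eta$ on $[-m,m]$ and to $1$ elsewhere. The sandpile process is the Markov process on $\Omega$ whose transition probabilities $P_t(\eta,\cdot)$ are the probability measures with $$\int f\,dP_t(\eta,\cdot)=S(t)f(\eta):=\lim_{n\to\infty}\lim_{m\to\infty}S_n(t)f(\eta^m)$$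 for all continuous monotone $f:\Omega\to\mathbb R$. **Proposition 5.1.** The Dirac measure $\delta_2$ on the configuration $\hat 2\equiv 2$ is invariant for the sandpile process: $\delta_2P_t=\delta_2$ for all $t\ge 0$. In particular, for all $t\ge0$ and all continuous monotone $f$, the limits that define $S(t)f(\hat 2)$ exist and $S(t)f(\hat 2)=f(\hat 2)$. Moreover, if $A(t)$ is the pure avalanche chain (jumping with rate $1$ from $A$ to $T_iA$ for each $i\in A$, without births), started from $A(0)=[-n,n]\cap\mathbb Z$, then for all $n\ge 0$ and $t\ge 0$ the law of $A(t)$ has total mass one (the chain does not explode) and $$P(0\notin A(t))\le\frac1{2n+1}.$$ -/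

import Mathlib

open MeasureTheory Filter Topology
open scoped ENNReal

namespace Sandpile

/-- The state space `{1,2}^ℤ`, with the pointwise order, the product topology and the product
(Borel) σ-algebra. -/
abbrev Config : Type := ℤ → Set.Icc (1 : ℕ) 2

/-- The height `1`. -/
def low : Set.Icc (1 : ℕ) 2 := ⟨1, by norm_num, by norm_num⟩

/-- The threshold height `2`. -/
def high : Set.Icc (1 : ℕ) 2 := ⟨2, by norm_num, by norm_num⟩

/-- The configuration that is identically `2`. -/
def allTwo : Config := fun _ => high

/-- The configuration `η_A` whose set of critical sites (sites of height `2`) is `A`. These are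
exactly the configurations with finitely many critical sites. -/
def configOf (A : Finset ℤ) : Config := fun x => if x ∈ A then high else low

/-- `inf {j ≥ 0 : η_A (i + j) = 1}`; the set is never empty, as `A` is finite. -/
noncomputable def kPlus (i : ℤ) (A : Finset ℤ) : ℕ :=
  sInf {j : ℕ | configOf A (i + j) = low}

/-- `inf {j > 0 : η_A (i - j) = 1}`; the set is never empty, as `A` is finite. -/
noncomputable def kMinus (i : ℤ) (A : Finset ℤ) : ℕ :=
  sInf {j : ℕ | 0 < j ∧ configOf A (i - j) = low}

/-- The toppling transformation `T_i`, on sets of critical sites. A grain added at a site of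
height `1` makes that site critical. A grain added at a critical site causes an avalanche, which
fills the first sites of height `1` on both sides and leaves a site of height `1` at
`i + k⁺ - k⁻`. -/
noncomputable def addGrain (i : ℤ) (A : Finset ℤ) : Finset ℤ :=
  if i ∈ A then
    (A \ {i + (kPlus i A : ℤ) - (kMinus i A : ℤ)}) ∪
      {i + (kPlus i A : ℤ), i - (kMinus i A : ℤ)}
  else insert i A

/-- The total jump rate `|A ∪ B|` out of `A`, in the chain described at `transProb`. -/
noncomputable def jumpRate (B A : Finset ℤ) : ℝ := ((A ∪ B).card : ℝ)

/-- `transProbLE B k t A C` is the probability that the chain described at `transProb`, started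
from `A`, is in `C` at time `t` and has made at most `k` jumps until then. The recursion
decomposes according to the time `s` and the target of the first jump. -/
noncomputable def transProbLE (B : Finset ℤ) : ℕ → ℝ → Finset ℤ → Finset ℤ → ℝ≥0∞
  | 0, t, A, C => if A = C then ENNReal.ofReal (Real.exp (-(jumpRate B A * t))) else 0
  | k + 1, t, A, C =>
      (if A = C then ENNReal.ofReal (Real.exp (-(jumpRate B A * t))) else 0) +
        ∫⁻ s in Set.Icc (0 : ℝ) t, ENNReal.ofReal (Real.exp (-(jumpRate B A * s))) *
          ∑ i ∈ A ∪ B, transProbLE B k (t - s) (addGrain i A) C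

/-- The transition function of the continuous-time Markov chain on finite sets of critical sites
with avalanches everywhere and births in `B`, that is, with generator
`∑_{i : η(i) = 2} [f(T_i η) - f(η)] + ∑_{i ∈ B : η(i) = 1} [f(T_i η) - f(η)]`:
from `A` the chain jumps with rate `1` to `T_i A`, for each `i ∈ A ∪ B`. -/
noncomputable def transProb (B : Finset ℤ) (t : ℝ) (A C : Finset ℤ) : ℝ≥0∞ :=
  ⨆ k : ℕ, transProbLE B k t A C

/-- The law at time `t`, on the space of configurations, of that chain started from `η_A`. -/
noncomputable def chainLaw (B : Finset ℤ) (t : ℝ) (A : Finset ℤ) : Measure Config :=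
  Measure.sum fun C : Finset ℤ => transProb B t A C • Measure.dirac (configOf C)

/-- The law at time `t` of the pure avalanche chain (no births) started from `η_A`. -/
noncomputable def avalancheLaw (t : ℝ) (A : Finset ℤ) : Measure Config := chainLaw ∅ t A

/-- The expectation `S_n(t) f (η_A)`, for avalanches everywhere and births in `[-n, n]`. -/
noncomputable def finSemigroup (n : ℕ) (t : ℝ) (f : Config → ℝ) (A : Finset ℤ) : ℝ :=
  ∫ ζ, f ζ ∂(chainLaw (Finset.Icc (-(n : ℤ)) n) t A)

/-- The set of critical sites of the configuration that agrees with `η` in `[-m, m]` and has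
height `1` elsewhere. -/
noncomputable def truncation (m : ℕ) (η : Config) : Finset ℤ :=
  (Finset.Icc (-(m : ℤ)) m).filter fun x => η x = high

/-- `S(t) f (η) = v`, where `S(t) f (η) = lim_n lim_{η' ↑ η} S_n(t) f (η')` and the inner limit
is along the truncations of `η`: both limits exist and the outer one is `v`. -/
def HasSemigroupValue (t : ℝ) (f : Config → ℝ) (η : Config) (v : ℝ) : Prop :=
  ∃ g : ℕ → ℝ,
    (∀ n : ℕ, Tendsto (fun m : ℕ => finSemigroup n t f (truncation m η)) atTop (𝓝 (g n))) ∧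
      Tendsto g atTop (𝓝 v)

/-- `μ` is the law at time `t` of the sandpile process started from `η`: it is a probability
measure and `S(t) f (η) = ∫ f dμ` for every monotone continuous `f`. As monotone continuous
functions separate probability measures, there is at most one such `μ`. -/
def IsTransitionLaw (t : ℝ) (η : Config) (μ : Measure Config) : Prop :=
  IsProbabilityMeasure μ ∧
    ∀ f : Config → ℝ, Continuous f → Monotone f → HasSemigroupValue t f η (∫ ζ, f ζ ∂μ)

open Classical in
/-- The transition probability `P_t(η, ·)` of the sandpile process. -/
noncomputable def sandpileLaw (t : ℝ) (η : Config) : Measure Config :=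
  if h : ∃ μ : Measure Config, IsTransitionLaw t η μ then h.choose else 0

/-- `μ` is invariant for the sandpile process: `μ P_t = μ` for all `t ≥ 0`. -/
def IsInvariant (μ : Measure Config) : Prop :=
  ∀ t : ℝ, 0 ≤ t → μ.bind (sandpileLaw t) = μ

end Sandpile

namespace Sandpile

/-! Every jump raises the number of critical sites by exactly one, and an interval with at most one
interior hole keeps this shape as long as births fall inside it (`IsNearInterval.addGrain`). If `x`
is the hole, the next jump fills it; if `x` is critical, only one jump can open a hole there
(`IsNearInterval.card_filter_notMem_addGrain_le`). From a set of `N` sites the jump rate is between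
`N` and `N + 1`, so the hole is roughly uniformly distributed: induction on the number of jumps
gives `P(x ∉ A(t)) ≤ (1 - e^{-Nt}) / N` when `x` starts critical (`IsNearInterval.expectLE_le`).

The chain does not explode, because the jump rate is at most linear in the number of jumps made
(`expectLE_one_ge`). Started from `[-m, m]`, its laws are thus probability measures under which each
fixed site is critical with probability tending to one as `m → ∞`, so they converge weakly to the
Dirac measure on `allTwo`. This limit does not depend on `n`, so the outer limit is trivial. -/

/-! ### Avalanches on finite critical sets. -/

theorem configOf_eq_low_iff {A : Finset ℤ} {x : ℤ} : configOf A x = low ↔ x ∉ A := by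
  unfold configOf
  split_ifs with h <;> simp only [h, high, low] <;> decide

theorem configOf_eq_high_iff {A : Finset ℤ} {x : ℤ} : configOf A x = high ↔ x ∈ A := by
  unfold configOf
  split_ifs with h
  · simp [h]
  · simp only [h, high, low]
    decide

/-- An avalanche at `i ∈ A` acts on the maximal block `(a, b)` of critical sites around `i`. -/
theorem addGrain_of_mem {i : ℤ} {A : Finset ℤ} (hi : i ∈ A) :
    ∃ a b : ℤ, a < i ∧ i < b ∧ a ∉ A ∧ b ∉ A ∧ (∀ y, a < y → y < b → y ∈ A) ∧
      addGrain i A = (A \ {a + b - i}) ∪ {b, a} := by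
  have hplus : {j : ℕ | configOf A (i + j) = low}.Nonempty := by
    obtain ⟨M, hM⟩ := A.bddAbove
    refine ⟨(M - i).toNat + 1, ?_⟩
    simp only [Set.mem_ofPred_eq, configOf_eq_low_iff]
    intro h
    have := hM h
    push_cast at this
    omega
  have hminus : {j : ℕ | 0 < j ∧ configOf A (i - j) = low}.Nonempty := by
    obtain ⟨M, hM⟩ := A.bddBelow
    refine ⟨(i - M).toNat + 1, ?_⟩
    simp only [Set.mem_ofPred_eq, configOf_eq_low_iff]
    refine ⟨by omega, fun h => ?_⟩
    have := hM h
    push_cast at this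
    omega
  have hp := Nat.sInf_mem hplus
  have hm := Nat.sInf_mem hminus
  have hp' : ∀ j : ℕ, j < kPlus i A → i + j ∈ A := fun j hj => by
    by_contra hc
    exact Nat.notMem_of_lt_sInf hj (configOf_eq_low_iff.2 hc)
  have hm' : ∀ j : ℕ, 0 < j → j < kMinus i A → i - j ∈ A := fun j h0 hj => by
    by_contra hc
    exact Nat.notMem_of_lt_sInf hj ⟨h0, configOf_eq_low_iff.2 hc⟩
  change configOf A (i + kPlus i A) = low at hp
  change 0 < kMinus i A ∧ configOf A (i - kMinus i A) = low at hm
  rw [configOf_eq_low_iff] at hp hm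
  have hp0 : kPlus i A ≠ 0 := fun h => hp (by simpa [h] using hi)
  refine ⟨i - kMinus i A, i + kPlus i A, by omega, by omega, hm.2, hp, fun y h1 h2 => ?_, ?_⟩
  · rcases lt_trichotomy y i with h | h | h
    · have := hm' (i - y).toNat (by omega) (by omega)
      rwa [Int.toNat_of_nonneg (by omega), sub_sub_cancel] at this
    · rwa [h]
    · have := hp' (y - i).toNat (by omega)
      rwa [Int.toNat_of_nonneg (by omega), add_sub_cancel] at this
  · rw [addGrain, if_pos hi]
    congr 3
    ring

/-- An avalanche empties one site of the block and fills the two distinct sites that bound it. -/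
theorem card_addGrain (i : ℤ) (A : Finset ℤ) : (addGrain i A).card = A.card + 1 := by
  by_cases hi : i ∈ A
  · obtain ⟨a, b, ha, hb, haA, hbA, hab, h⟩ := addGrain_of_mem hi
    have hc : a + b - i ∈ A := hab _ (by omega) (by omega)
    have hdisj : Disjoint (A \ {a + b - i}) {b, a} := by
      rw [Finset.disjoint_left]
      intro y hy
      simp only [Finset.mem_sdiff, Finset.mem_insert, Finset.mem_singleton] at hy ⊢
      rintro (rfl | rfl)
      · exact hbA hy.1
      · exact haA hy.1
    rw [h, Finset.card_union_of_disjoint hdisj, Finset.sdiff_singleton_eq_erase,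
      Finset.card_erase_of_mem hc, Finset.card_pair (by omega)]
    have := Finset.card_pos.2 ⟨_, hc⟩
    omega
  · rw [addGrain, if_neg hi, Finset.card_insert_of_notMem hi]

/-! ### Intervals with at most one hole. -/

/-- `A` is an interval with at most one, interior, hole; the interval contains `B` and `x`. -/
def IsNearInterval (B : Finset ℤ) (x : ℤ) (A : Finset ℤ) : Prop :=
  ∃ l r : ℤ, l ∈ A ∧ r ∈ A ∧ (∀ y ∈ A, l ≤ y ∧ y ≤ r) ∧ (∀ y ∈ B, l ≤ y ∧ y ≤ r) ∧
    (l ≤ x ∧ x ≤ r) ∧ ∀ y z, l ≤ y → y ≤ r → l ≤ z → z ≤ r → y ∉ A → z ∉ A → y = z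

section NearInterval

variable {B A : Finset ℤ} {x : ℤ}

theorem isNearInterval_Icc {l r : ℤ} (hB : B ⊆ Finset.Icc l r) (hx : x ∈ Finset.Icc l r) :
    IsNearInterval B x (Finset.Icc l r) := by
  have hx' := Finset.mem_Icc.1 hx
  refine ⟨l, r, by simp; omega, by simp; omega, by simp, fun y hy => Finset.mem_Icc.1 (hB hy),
    hx', fun y z h1 h2 _ _ hy => absurd (Finset.mem_Icc.2 ⟨h1, h2⟩) hy⟩

theorem IsNearInterval.nonempty (h : IsNearInterval B x A) : A.Nonempty := by
  obtain ⟨l, _, hl, _⟩ := h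
  exact ⟨l, hl⟩

/-- Only the hole can lie in `B \ A`, so births add at most one to the jump rate. -/
theorem IsNearInterval.card_union_le (h : IsNearInterval B x A) :
    (A ∪ B).card ≤ A.card + 1 := by
  obtain ⟨l, r, hl, hr, hA, hB, hx, hu⟩ := h
  have h1 : (B \ A).card ≤ 1 := by
    rw [Finset.card_le_one]
    intro y hy z hz
    rw [Finset.mem_sdiff] at hy hz
    exact hu y z (hB y hy.1).1 (hB y hy.1).2 (hB z hz.1).1 (hB z hz.1).2 hy.2 hz.2
  have h2 := Finset.card_union_le A (B \ A)
  rw [Finset.union_sdiff_self_eq_union] at h2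
  omega

theorem IsNearInterval.addGrain (h : IsNearInterval B x A) {i : ℤ} (hi : i ∈ A ∪ B) :
    IsNearInterval B x (addGrain i A) := by
  obtain ⟨l, r, hl, hr, hA, hB, hx, hu⟩ := h
  by_cases hiA : i ∈ A
  · obtain ⟨a, b, ha, hb, haA, hbA, hab, h⟩ := addGrain_of_mem hiA
    have hli := hA i hiA
    have hla : l - 1 ≤ a := by
      by_contra hc
      have := hA _ (hab (l - 1) (by omega) (by omega))
      omega
    have hbr : b ≤ r + 1 := by
      by_contra hc
      have := hA _ (hab (r + 1) (by omega) (by omega))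
      omega
    have hal : a ≠ l := fun h => haA (h ▸ hl)
    have hbr' : b ≠ r := fun h => hbA (h ▸ hr)
    have mem : ∀ y, y ∈ Sandpile.addGrain i A ↔ (y ∈ A ∧ y ≠ a + b - i) ∨ y = b ∨ y = a := by
      intro y
      simp [h]
      tauto
    -- An end of the block lying in `[l, r]` is the old hole, which gets filled. If neither end lies
    -- there, the block covers all of `[l, r]`.
    have key : ∀ y, min l a ≤ y → y ≤ max r b → y ∉ Sandpile.addGrain i A → y = a + b - i := by
      intro y h1 h2 h3
      rw [mem] at h3
      push Not at h3
      by_contra hc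
      have hyA : y ∉ A := fun hy => hc (h3.1 hy)
      have hly : l ≤ y := by omega
      have hyr : y ≤ r := by omega
      by_cases hal' : l ≤ a
      · exact h3.2.2 (hu y a hly hyr hal' (by omega) hyA haA)
      by_cases hbr'' : b ≤ r
      · exact h3.2.1 (hu y b hly hyr (by omega) hbr'' hyA hbA)
      exact hyA (hab y (by omega) (by omega))
    refine ⟨min l a, max r b, ?_, ?_, ?_, ?_, by omega, ?_⟩
    · rw [mem]
      rcases le_or_gt l a with h | h
      · rw [min_eq_left h]
        exact Or.inl ⟨hl, by omega⟩
      · rw [min_eq_right h.le]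
        exact Or.inr (Or.inr rfl)
    · rw [mem]
      rcases le_or_gt b r with h | h
      · rw [max_eq_left h]
        exact Or.inl ⟨hr, by omega⟩
      · rw [max_eq_right h.le]
        exact Or.inr (Or.inl rfl)
    · intro y hy
      rw [mem] at hy
      rcases hy with hy | hy | hy
      · have := hA y hy.1
        omega
      · omega
      · omega
    · intro y hy
      have := hB y hy
      omega
    · intro y z h1 h2 h3 h4 hy hz
      rw [key y h1 h2 hy, key z h3 h4 hz]
  · have hiB : i ∈ B := by simpa [hiA] using hi
    have := hB i hiB
    rw [Sandpile.addGrain, if_neg hiA]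
    refine ⟨l, r, by simp [hl], by simp [hr], ?_, hB, hx, ?_⟩
    · intro y hy
      rcases Finset.mem_insert.1 hy with rfl | hy
      · exact this
      · exact hA y hy
    · intro y z h1 h2 h3 h4 hy hz
      rw [Finset.mem_insert] at hy hz
      exact hu y z h1 h2 h3 h4 (fun h => hy (Or.inr h)) (fun h => hz (Or.inr h))

/-- At most one of the possible jumps makes `x` uncritical. -/
theorem IsNearInterval.card_filter_notMem_addGrain_le (h : IsNearInterval B x A) :
    ((A ∪ B).filter fun i => x ∉ Sandpile.addGrain i A).card ≤ 1 := by
  obtain ⟨l, r, hl, hr, hA, hB, hx, hu⟩ := h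
  have key : ∀ i ∈ A ∪ B, x ∉ Sandpile.addGrain i A →
      ∃ a b, a ∉ A ∧ b ∉ A ∧ a < x ∧ x < b ∧ (∀ y, a < y → y < b → y ∈ A) ∧ i = a + b - x := by
    intro i hi hxi
    by_cases hiA : i ∈ A
    · obtain ⟨a, b, ha, hb, haA, hbA, hab, h⟩ := addGrain_of_mem hiA
      have mem : x ∈ Sandpile.addGrain i A ↔ (x ∈ A ∧ x ≠ a + b - i) ∨ x = b ∨ x = a := by
        simp [h]
        tauto
      rw [mem] at hxi
      push Not at hxi
      have hli := hA i hiA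
      -- If `x` were the hole, any end of the block inside `[l, r]` would be `x`, and the avalanche
      -- would fill it.
      have hxA : x ∈ A := by
        by_contra hxA
        by_cases hal : l ≤ a
        · exact hxi.2.2 (hu x a hx.1 hx.2 hal (by omega) hxA haA)
        by_cases hbr : b ≤ r
        · exact hxi.2.1 (hu x b hx.1 hx.2 (by omega) hbr hxA hbA)
        exact hxA (hab x (by omega) (by omega))
      have := hxi.1 hxA
      exact ⟨a, b, haA, hbA, by omega, by omega, hab, by omega⟩
    · have hiB : i ∈ B := by simpa [hiA] using hi
      rw [Sandpile.addGrain, if_neg hiA, Finset.mem_insert] at hxi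
      push Not at hxi
      exact absurd (hu x i hx.1 hx.2 (hB i hiB).1 (hB i hiB).2 hxi.2 hiA) hxi.1
  -- The ends `a`, `b` of the block around `x` are determined by `x`, hence so is the reflected site
  -- `a + b - x`.
  rw [Finset.card_le_one]
  intro i hi j hj
  rw [Finset.mem_filter] at hi hj
  obtain ⟨a, b, ha, hb, hax, hxb, hab, rfl⟩ := key i hi.1 hi.2
  obtain ⟨a', b', ha', hb', hax', hxb', hab', rfl⟩ := key j hj.1 hj.2
  have h1 : a = a' := by
    rcases lt_trichotomy a a' with h | h | h
    · exact absurd (hab a' h (by omega)) ha'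
    · exact h
    · exact absurd (hab' a h (by omega)) ha
  have h2 : b = b' := by
    rcases lt_trichotomy b b' with h | h | h
    · exact absurd (hab' b (by omega) h) hb
    · exact h
    · exact absurd (hab b' (by omega) h) hb'
  rw [h1, h2]

end NearInterval

/-! ### Exponential integrals. -/

theorem ofReal_integral_le_lintegral_ofReal {α : Type*} [MeasurableSpace α] (μ : Measure α)
    (f : α → ℝ) : ENNReal.ofReal (∫ x, f x ∂μ) ≤ ∫⁻ x, ENNReal.ofReal (f x) ∂μ := by
  by_cases hf : Integrable f μ
  · calc ENNReal.ofReal (∫ x, f x ∂μ) ≤ ENNReal.ofReal (∫ x, max (f x) 0 ∂μ) :=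
          ENNReal.ofReal_le_ofReal (integral_mono hf hf.pos_part fun x => le_max_left _ _)
      _ = ∫⁻ x, ENNReal.ofReal (max (f x) 0) ∂μ :=
          ofReal_integral_eq_lintegral_ofReal hf.pos_part (ae_of_all _ fun x => le_max_right _ _)
      _ = ∫⁻ x, ENNReal.ofReal (f x) ∂μ := by
          refine lintegral_congr fun x => ?_
          rcases le_total (f x) 0 with h | h
          · rw [max_eq_right h, ENNReal.ofReal_zero, ENNReal.ofReal_of_nonpos h]
          · rw [max_eq_left h]
  · simp [integral_undef hf]

theorem setIntegral_Icc_eq_sub {f F : ℝ → ℝ} (hf : Continuous f)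
    (hF : ∀ s, HasDerivAt F (f s) s) {t : ℝ} (ht : 0 ≤ t) :
    ∫ s in Set.Icc 0 t, f s = F t - F 0 := by
  rw [integral_Icc_eq_integral_Ioc, ← intervalIntegral.integral_of_le ht]
  exact intervalIntegral.integral_eq_sub_of_hasDerivAt (fun s _ => hF s)
    (hf.intervalIntegrable _ _)

theorem setLIntegral_Icc_eq_ofReal_sub {f F : ℝ → ℝ} (hf : Continuous f) (hf0 : ∀ s, 0 ≤ f s)
    (hF : ∀ s, HasDerivAt F (f s) s) {t : ℝ} (ht : 0 ≤ t) :
    ∫⁻ s in Set.Icc 0 t, ENNReal.ofReal (f s) = ENNReal.ofReal (F t - F 0) := by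
  rw [← setIntegral_Icc_eq_sub hf hF ht, ofReal_integral_eq_lintegral_ofReal
    (hf.continuousOn.integrableOn_compact isCompact_Icc) (ae_of_all _ hf0)]

/-- Only an inequality: `f` may change sign, and `ENNReal.ofReal` discards its negative part. -/
theorem ofReal_sub_le_setLIntegral_Icc {f F : ℝ → ℝ} (hf : Continuous f)
    (hF : ∀ s, HasDerivAt F (f s) s) {t : ℝ} (ht : 0 ≤ t) :
    ENNReal.ofReal (F t - F 0) ≤ ∫⁻ s in Set.Icc 0 t, ENNReal.ofReal (f s) := by
  rw [← setIntegral_Icc_eq_sub hf hF ht]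
  exact ofReal_integral_le_lintegral_ofReal _ _

theorem hasDerivAt_exp_neg_mul (c s : ℝ) :
    HasDerivAt (fun s => Real.exp (-(c * s))) (-c * Real.exp (-(c * s))) s := by
  have := ((hasDerivAt_id' s).const_mul (-c)).exp
  simpa only [neg_mul, mul_one, mul_neg, mul_comm c] using this

theorem setLIntegral_mul_exp {c : ℝ} (hc : 0 ≤ c) {t : ℝ} (ht : 0 ≤ t) :
    ∫⁻ s in Set.Icc 0 t, ENNReal.ofReal (c * Real.exp (-(c * s))) =
      ENNReal.ofReal (1 - Real.exp (-(c * t))) := by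
  rw [setLIntegral_Icc_eq_ofReal_sub (F := fun s => -Real.exp (-(c * s))) (by fun_prop)
    (fun s => by positivity)
    (fun s => by simpa using (hasDerivAt_exp_neg_mul c s).fun_neg) ht]
  congr 1
  simp
  ring

theorem setLIntegral_exp {c : ℝ} (hc : 0 < c) {t : ℝ} (ht : 0 ≤ t) :
    ∫⁻ s in Set.Icc 0 t, ENNReal.ofReal (Real.exp (-(c * s))) =
      ENNReal.ofReal ((1 - Real.exp (-(c * t))) / c) := by
  rw [setLIntegral_Icc_eq_ofReal_sub (F := fun s => -Real.exp (-(c * s)) / c) (by fun_prop)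
    (fun s => by positivity)
    (fun s => (((hasDerivAt_exp_neg_mul c s).fun_neg).div_const c).congr_deriv (by
      rw [neg_mul, neg_neg, mul_div_cancel_left₀ _ hc.ne'])) ht]
  congr 1
  simp
  ring

/-! ### First-jump recursion for expectations. -/

theorem measurable_transProbLE (B : Finset ℤ) (k : ℕ) (A C : Finset ℤ) :
    Measurable fun t => transProbLE B k t A C := by
  induction k generalizing A with
  | zero =>
    unfold transProbLE
    split_ifs <;> fun_prop
  | succ k ih =>
    unfold transProbLE
    refine Measurable.add (by split_ifs <;> fun_prop) ?_
    have h : ∀ t : ℝ, ∫⁻ s in Set.Icc (0 : ℝ) t, ENNReal.ofReal (Real.exp (-(jumpRate B A * s))) *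
          ∑ i ∈ A ∪ B, transProbLE B k (t - s) (addGrain i A) C =
        ∫⁻ s, {p : ℝ × ℝ | 0 ≤ p.2 ∧ p.2 ≤ p.1}.indicator (fun p =>
          ENNReal.ofReal (Real.exp (-(jumpRate B A * p.2))) *
            ∑ i ∈ A ∪ B, transProbLE B k (p.1 - p.2) (addGrain i A) C) (t, s) := fun t => by
      rw [← lintegral_indicator measurableSet_Icc]
      rfl
    simp_rw [h]
    refine Measurable.lintegral_prod_right (f := fun t s => _) ?_
    refine Measurable.indicator ?_ ?_
    · refine Measurable.mul (by fun_prop) (Finset.measurable_fun_sum _ fun i _ => ?_)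
      exact (ih _).comp (measurable_fst.sub measurable_snd)
    · exact (measurableSet_le measurable_const measurable_snd).inter
        (measurableSet_le measurable_snd measurable_fst)

theorem transProbLE_le_succ (B : Finset ℤ) (k : ℕ) (t : ℝ) (A C : Finset ℤ) :
    transProbLE B k t A C ≤ transProbLE B (k + 1) t A C := by
  induction k generalizing t A with
  | zero =>
    rw [transProbLE, transProbLE]
    exact le_self_add
  | succ k ih =>
    rw [transProbLE, transProbLE]
    gcongr
    exact ih _ _

/-- The expectation of `g` at time `t`, on the event of at most `k` jumps until then. -/
noncomputable def expectLE (B : Finset ℤ) (k : ℕ) (g : Finset ℤ → ℝ≥0∞) (t : ℝ)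
    (A : Finset ℤ) : ℝ≥0∞ :=
  ∑' C, transProbLE B k t A C * g C

section Expectation

variable (B : Finset ℤ) (g : Finset ℤ → ℝ≥0∞) (t : ℝ) (A : Finset ℤ)

theorem tsum_ite_eq_mul (a : ℝ≥0∞) :
    ∑' C, (if A = C then a else 0) * g C = a * g A := by
  rw [tsum_eq_single A fun C hC => by rw [if_neg hC.symm, zero_mul], if_pos rfl]

theorem expectLE_zero :
    expectLE B 0 g t A = ENNReal.ofReal (Real.exp (-(jumpRate B A * t))) * g A := by
  simp only [expectLE, transProbLE, tsum_ite_eq_mul]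

theorem expectLE_succ (k : ℕ) :
    expectLE B (k + 1) g t A = ENNReal.ofReal (Real.exp (-(jumpRate B A * t))) * g A +
      ∫⁻ s in Set.Icc (0 : ℝ) t, ENNReal.ofReal (Real.exp (-(jumpRate B A * s))) *
        ∑ i ∈ A ∪ B, expectLE B k g (t - s) (addGrain i A) := by
  have hm : ∀ C, Measurable fun s => ENNReal.ofReal (Real.exp (-(jumpRate B A * s))) *
      ∑ i ∈ A ∪ B, transProbLE B k (t - s) (addGrain i A) C := fun C => by
    refine Measurable.mul (by fun_prop) (Finset.measurable_fun_sum _ fun i _ => ?_)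
    exact (measurable_transProbLE B k _ C).comp (measurable_const.sub measurable_id)
  simp only [expectLE, transProbLE, add_mul]
  rw [ENNReal.tsum_add, tsum_ite_eq_mul]
  congr 1
  calc _ = ∑' C, ∫⁻ s in Set.Icc (0 : ℝ) t, ENNReal.ofReal (Real.exp (-(jumpRate B A * s))) *
        (∑ i ∈ A ∪ B, transProbLE B k (t - s) (addGrain i A) C) * g C :=
        tsum_congr fun C => (lintegral_mul_const _ (hm C)).symm
    _ = _ := by
        rw [← lintegral_tsum fun C => ((hm C).mul_const _).aemeasurable]
        refine lintegral_congr fun s => ?_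
        simp_rw [mul_assoc, Finset.sum_mul]
        rw [ENNReal.tsum_mul_left, Summable.tsum_finsetSum fun _ _ => ENNReal.summable]

/-- Monotone convergence in the number of jumps; it reduces every estimate on the chain to an
induction on `k`. -/
theorem tsum_transProb_mul :
    ∑' C, transProb B t A C * g C = ⨆ k, expectLE B k g t A := by
  have hmono : ∀ C, Monotone fun k => transProbLE B k t A C * g C := fun C =>
    monotone_nat_of_le_succ fun k => by gcongr; exact transProbLE_le_succ B k t A C
  simp_rw [expectLE, transProb, ENNReal.iSup_mul, ENNReal.tsum_eq_iSup_sum,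
    ENNReal.finsetSum_iSup_of_monotone hmono]
  exact iSup_comm

theorem chainLaw_apply {S : Set Config} (hS : MeasurableSet S) :
    chainLaw B t A S = ⨆ k, expectLE B k (fun C => S.indicator 1 (configOf C)) t A := by
  rw [← tsum_transProb_mul, chainLaw, Measure.sum_apply _ hS]
  simp [Measure.dirac_apply' _ hS]

end Expectation

/-! ### Total mass and non-explosion. -/

theorem jumpRate_nonneg (B A : Finset ℤ) : 0 ≤ jumpRate B A := Nat.cast_nonneg _

theorem ofReal_jumpRate (B A : Finset ℤ) :
    ENNReal.ofReal (jumpRate B A) = ((A ∪ B).card : ℝ≥0∞) := ENNReal.ofReal_natCast _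

theorem jumpRate_le (B A : Finset ℤ) : jumpRate B A ≤ A.card + B.card := by
  unfold jumpRate
  exact_mod_cast Finset.card_union_le A B

theorem expectLE_one_le_one (B : Finset ℤ) (k : ℕ) {t : ℝ} (ht : 0 ≤ t) (A : Finset ℤ) :
    expectLE B k (fun _ => 1) t A ≤ 1 := by
  have hr := jumpRate_nonneg B A
  have he : Real.exp (-(jumpRate B A * t)) ≤ 1 := Real.exp_le_one_iff.2 (by nlinarith)
  induction k generalizing t A with
  | zero =>
    rw [expectLE_zero, mul_one]
    exact ENNReal.ofReal_le_one.2 he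
  | succ k ih =>
    rw [expectLE_succ, mul_one]
    calc _ ≤ ENNReal.ofReal (Real.exp (-(jumpRate B A * t))) + ∫⁻ s in Set.Icc (0 : ℝ) t,
          ENNReal.ofReal (jumpRate B A * Real.exp (-(jumpRate B A * s))) := by
          refine add_le_add le_rfl ?_
          refine setLIntegral_mono' measurableSet_Icc fun s hs => ?_
          rw [ENNReal.ofReal_mul hr, ofReal_jumpRate, mul_comm (Nat.cast _)]
          gcongr
          refine (Finset.sum_le_card_nsmul _ _ 1 fun i _ => ?_).trans (by simp)
          refine ih (sub_nonneg.2 hs.2) _ (jumpRate_nonneg _ _) (Real.exp_le_one_iff.2 ?_)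
          nlinarith [jumpRate_nonneg B (addGrain i A), hs.2]
      _ = 1 := by
          rw [setLIntegral_mul_exp hr ht, ← ENNReal.ofReal_add (Real.exp_nonneg _) (by linarith)]
          simp

/-- The bound is of Markov type: `|A(t)| + |B|` grows at a rate at most its own size, so its mean is
at most `(|A| + |B|) e^t`, while more than `k` jumps push it above `|A| + |B| + k`. The proof is a
direct induction by the first jump. -/
theorem expectLE_one_ge (B : Finset ℤ) (k : ℕ) {t : ℝ} (ht : 0 ≤ t) {A : Finset ℤ}
    (hA : A.Nonempty) :
    ENNReal.ofReal (1 - (A.card + B.card) * Real.exp t / (A.card + B.card + k)) ≤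
      expectLE B k (fun _ => 1) t A := by
  have hm : (0 : ℝ) < A.card + B.card := by
    have : (0 : ℝ) < A.card := by exact_mod_cast hA.card_pos
    positivity
  have het := Real.one_le_exp ht
  induction k generalizing t A with
  | zero =>
    rw [ENNReal.ofReal_of_nonpos]
    · exact zero_le
    · rw [Nat.cast_zero, add_zero, mul_div_assoc, mul_div_cancel₀ _ hm.ne']
      linarith
  | succ k ih =>
    set r := jumpRate B A with hrdef
    have hr : 0 ≤ r := jumpRate_nonneg B A
    set m : ℝ := A.card + B.card with hmdef
    have hrm : r ≤ m := jumpRate_le B A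
    -- `c * exp (t - s)` is the error in the inductive bound after a first jump at time `s`, when
    -- `m` has become `m + 1`.
    set c : ℝ := (m + 1) / (m + 1 + k) with hc
    have hc0 : 0 ≤ c := by positivity
    have hderiv : ∀ s, HasDerivAt
        (fun s => -Real.exp (-(r * s)) + c * Real.exp t * (r / (r + 1)) * Real.exp (-((r + 1) * s)))
        (r * Real.exp (-(r * s)) - c * Real.exp t * r * Real.exp (-((r + 1) * s))) s := fun s => by
      refine (((hasDerivAt_exp_neg_mul r s).fun_neg).fun_add ((hasDerivAt_exp_neg_mul
        (r + 1) s).const_mul (c * Real.exp t * (r / (r + 1))))).congr_deriv ?_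
      field_simp
      ring
    have hlow := ofReal_sub_le_setLIntegral_Icc (by fun_prop) hderiv ht
    rw [expectLE_succ, mul_one]
    calc _ ≤ ENNReal.ofReal (Real.exp (-(r * t))) + ENNReal.ofReal _ :=
          (ENNReal.ofReal_le_ofReal ?_).trans ENNReal.ofReal_add_le
      _ ≤ _ := add_le_add_right (hlow.trans ?_) _
    · simp only [mul_zero, neg_zero, Real.exp_zero, Nat.cast_succ, mul_one]
      have h1 : c * (r / (r + 1)) ≤ m / (m + 1 + k) := by
        have : r / (r + 1) ≤ m / (m + 1) := by
          rw [div_le_div_iff₀ (by positivity) (by positivity)]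
          nlinarith
        calc c * (r / (r + 1)) ≤ c * (m / (m + 1)) := by gcongr
          _ = _ := by rw [hc]; field_simp
      have h2 : 0 ≤ c * Real.exp t * (r / (r + 1)) * Real.exp (-((r + 1) * t)) := by positivity
      have h3 := mul_le_mul_of_nonneg_right h1 (Real.exp_nonneg t)
      have h4 : m * Real.exp t / (m + (k + 1)) = m / (m + 1 + k) * Real.exp t := by
        rw [div_mul_eq_mul_div]
        congr 1
        ring
      rw [h4]
      linarith
    · refine setLIntegral_mono' measurableSet_Icc fun s hs => ?_
      have h : r * Real.exp (-(r * s)) - c * Real.exp t * r * Real.exp (-((r + 1) * s)) =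
          Real.exp (-(r * s)) * (r * (1 - c * Real.exp (t - s))) := by
        have : Real.exp t * Real.exp (-((r + 1) * s)) =
            Real.exp (-(r * s)) * Real.exp (t - s) := by
          rw [← Real.exp_add, ← Real.exp_add]
          congr 1
          ring
        linear_combination (-c * r) * this
      rw [h, ENNReal.ofReal_mul (Real.exp_nonneg _), ENNReal.ofReal_mul hr, ofReal_jumpRate]
      gcongr
      rw [← nsmul_eq_mul]
      refine Finset.card_nsmul_le_sum _ _ _ fun i _ => ?_
      have hcard : ((addGrain i A).card : ℝ) + B.card = m + 1 := by
        rw [card_addGrain, hmdef]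
        push_cast
        ring
      have := ih (sub_nonneg.2 hs.2) (A := addGrain i A)
        (Finset.card_pos.1 (by rw [card_addGrain]; omega)) (by rw [hcard]; positivity)
        (Real.one_le_exp (sub_nonneg.2 hs.2))
      rwa [hcard, mul_div_right_comm] at this

theorem isProbabilityMeasure_chainLaw (B : Finset ℤ) {t : ℝ} (ht : 0 ≤ t) {A : Finset ℤ}
    (hA : A.Nonempty) : IsProbabilityMeasure (chainLaw B t A) := by
  constructor
  rw [chainLaw_apply B t A MeasurableSet.univ]
  simp only [Set.indicator_univ, Pi.one_apply]
  refine le_antisymm (iSup_le fun k => expectLE_one_le_one B k ht A) ?_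
  have hlim : Tendsto (fun k : ℕ => ENNReal.ofReal
      (1 - (A.card + B.card) * Real.exp t / (A.card + B.card + k))) atTop (𝓝 1) := by
    have h : Tendsto (fun k : ℕ => 1 - ((A.card : ℝ) + B.card) * Real.exp t /
        (A.card + B.card + k)) atTop (𝓝 (1 - 0)) :=
      (tendsto_const_nhds.div_atTop
        (tendsto_atTop_add_const_left _ _ tendsto_natCast_atTop_atTop)).const_sub 1
    simpa using ENNReal.tendsto_ofReal h
  exact le_of_tendsto' hlim fun k => (expectLE_one_ge B k ht hA).trans
    (le_iSup (fun k => expectLE B k (fun _ => 1) t A) k)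

/-! ### The probability of a hole at a given site. -/

/-- Bound for the probability that `x` is not critical at time `t`. -/
theorem IsNearInterval.expectLE_le {B A : Finset ℤ} {x : ℤ} (h : IsNearInterval B x A) (k : ℕ)
    {t : ℝ} (ht : 0 ≤ t) :
    expectLE B k (fun C => if x ∈ C then 0 else 1) t A ≤
      (if x ∈ A then 0 else ENNReal.ofReal (Real.exp (-(A.card * t)))) +
        ENNReal.ofReal ((1 - Real.exp (-(A.card * t))) / A.card) := by
  have hrate : ∀ {A : Finset ℤ} {t : ℝ}, 0 ≤ t →
      Real.exp (-(jumpRate B A * t)) ≤ Real.exp (-(A.card * t)) := fun {A t} ht => by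
    have : (A.card : ℝ) ≤ jumpRate B A := by
      unfold jumpRate
      exact_mod_cast Finset.card_le_card Finset.subset_union_left
    gcongr
  have hfirst : ENNReal.ofReal (Real.exp (-(jumpRate B A * t))) * (if x ∈ A then 0 else 1) ≤
      if x ∈ A then 0 else ENNReal.ofReal (Real.exp (-(A.card * t))) := by
    split_ifs
    · simp
    · rw [mul_one]
      exact ENNReal.ofReal_le_ofReal (hrate ht)
  induction k generalizing t A with
  | zero =>
    rw [expectLE_zero]
    exact hfirst.trans le_self_add
  | succ k ih =>
    have hN : (0 : ℝ) < A.card := by exact_mod_cast h.nonempty.card_pos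
    rw [expectLE_succ]
    refine add_le_add hfirst ?_
    -- The second term is the integral of `exp (-(A.card * s))`, so it suffices that the sum over
    -- the targets of the first jump is at most one.
    rw [← setLIntegral_exp hN ht]
    refine setLIntegral_mono' measurableSet_Icc fun s hs => ?_
    refine (mul_le_of_le_one_right' ?_).trans (ENNReal.ofReal_le_ofReal (hrate hs.1))
    have hu : 0 ≤ t - s := sub_nonneg.2 hs.2
    set u := t - s
    set N : ℝ := A.card + 1 with hNdef
    have hN0 : 0 < N := by positivity
    have he : Real.exp (-(N * u)) ≤ 1 := Real.exp_le_one_iff.2 (by nlinarith)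
    have hcard : ∀ i, ((Sandpile.addGrain i A).card : ℝ) = N := fun i => by
      rw [card_addGrain, hNdef]
      push_cast
      ring
    -- At most one target lacks `x`, there are at most `N` targets, and each has `N` sites: the two
    -- terms add up to exactly one.
    calc ∑ i ∈ A ∪ B, expectLE B k (fun C => if x ∈ C then 0 else 1) u (Sandpile.addGrain i A)
        ≤ ∑ i ∈ A ∪ B, ((if x ∈ Sandpile.addGrain i A then 0 else ENNReal.ofReal (Real.exp (-(N * u)))) +
          ENNReal.ofReal ((1 - Real.exp (-(N * u))) / N)) := by
          refine Finset.sum_le_sum fun i hi => ?_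
          rw [← hcard i]
          refine ih (h.addGrain hi) hu ?_
          split_ifs
          · simp
          · rw [mul_one]
            exact ENNReal.ofReal_le_ofReal (hrate hu)
      _ ≤ ENNReal.ofReal (Real.exp (-(N * u))) +
          ENNReal.ofReal N * ENNReal.ofReal ((1 - Real.exp (-(N * u))) / N) := by
          rw [Finset.sum_add_distrib]
          refine add_le_add ?_ ?_
          · rw [Finset.sum_ite, Finset.sum_const_zero, zero_add, Finset.sum_const, nsmul_eq_mul]
            refine mul_le_of_le_one_left' ?_
            exact_mod_cast h.card_filter_notMem_addGrain_le
          · rw [Finset.sum_const, nsmul_eq_mul]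
            gcongr
            rw [← ENNReal.ofReal_natCast]
            refine ENNReal.ofReal_le_ofReal ?_
            rw [hNdef]
            exact_mod_cast h.card_union_le
      _ = 1 := by
          rw [← ENNReal.ofReal_mul hN0.le, mul_div_cancel₀ _ hN0.ne',
            ← ENNReal.ofReal_add (Real.exp_nonneg _) (by linarith)]
          simp

theorem measurableSet_ne_high (x : ℤ) : MeasurableSet {ζ : Config | ζ x ≠ high} :=
  measurableSet_eq_fun (measurable_pi_apply x) measurable_const |>.compl

theorem IsNearInterval.chainLaw_le {B A : Finset ℤ} {x : ℤ} (h : IsNearInterval B x A)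
    (hx : x ∈ A) {t : ℝ} (ht : 0 ≤ t) :
    chainLaw B t A {ζ | ζ x ≠ high} ≤ 1 / (A.card : ℝ≥0∞) := by
  have hN : (0 : ℝ) < A.card := by exact_mod_cast h.nonempty.card_pos
  rw [chainLaw_apply B t A (measurableSet_ne_high x)]
  refine iSup_le fun k => ?_
  have hg : (fun C => {ζ : Config | ζ x ≠ high}.indicator (1 : Config → ℝ≥0∞) (configOf C)) =
      fun C => if x ∈ C then 0 else 1 := by
    funext C
    by_cases hC : x ∈ C <;> simp [configOf_eq_high_iff, hC]
  rw [hg]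
  refine (h.expectLE_le k ht).trans ?_
  rw [if_pos hx, zero_add, ← ENNReal.ofReal_natCast, ← ENNReal.ofReal_one,
    ← ENNReal.ofReal_div_of_pos hN]
  gcongr
  linarith [Real.exp_nonneg (-(A.card * t))]

theorem chainLaw_Icc_le {B : Finset ℤ} {m : ℕ} (hB : B ⊆ Finset.Icc (-(m : ℤ)) m) {x : ℤ}
    (hx : x ∈ Finset.Icc (-(m : ℤ)) m) {t : ℝ} (ht : 0 ≤ t) :
    chainLaw B t (Finset.Icc (-(m : ℤ)) m) {ζ | ζ x ≠ high} ≤ 1 / (2 * (m : ℝ≥0∞) + 1) := by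
  refine ((isNearInterval_Icc hB hx).chainLaw_le hx ht).trans_eq ?_
  rw [Int.card_Icc, show ((m : ℤ) + 1 - -(m : ℤ)).toNat = 2 * m + 1 by omega]
  push_cast
  rfl

/-! ### Weak convergence and the transition law at `allTwo`. -/

theorem truncation_allTwo (m : ℕ) : truncation m allTwo = Finset.Icc (-(m : ℤ)) m :=
  Finset.filter_true_of_mem fun _ _ => rfl

theorem exists_finset_forall_abs_sub_le {f : Config → ℝ} (hf : Continuous f) (η : Config)
    {ε : ℝ} (hε : 0 < ε) :
    ∃ s : Finset ℤ, ∀ ζ : Config, (∀ x ∈ s, ζ x = η x) → |f ζ - f η| ≤ ε := by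
  have hU : {ζ | |f ζ - f η| < ε} ∈ 𝓝 η := by
    have := hf.continuousAt (x := η) (Metric.ball_mem_nhds (f η) hε)
    simpa [Metric.ball, Real.dist_eq] using this
  rw [nhds_pi, Filter.mem_pi] at hU
  obtain ⟨I, hI, u, hu, hsub⟩ := hU
  refine ⟨hI.toFinset, fun ζ hζ => le_of_lt (hsub fun x hx => ?_)⟩
  rw [hζ x (hI.mem_toFinset.2 hx)]
  exact mem_of_mem_nhds (hu x)

/-- If `μ m` are probability measures under which each site is eventually likely to be critical,
then they converge weakly to the Dirac measure on `allTwo`. -/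
theorem tendsto_integral_of_tendsto_measure {μ : ℕ → Measure Config}
    (hμ : ∀ m, IsProbabilityMeasure (μ m))
    (h : ∀ x, Tendsto (fun m => (μ m).real {ζ | ζ x ≠ high}) atTop (𝓝 0))
    {f : Config → ℝ} (hf : Continuous f) :
    Tendsto (fun m => ∫ ζ, f ζ ∂(μ m)) atTop (𝓝 (f allTwo)) := by
  obtain ⟨K, hK⟩ : ∃ K, ∀ ζ, |f ζ| ≤ K := by
    obtain ⟨K, hK⟩ := isCompact_univ.exists_bound_of_continuousOn hf.continuousOn
    exact ⟨K, fun ζ => hK ζ trivial⟩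
  have hK0 : 0 ≤ K := (abs_nonneg _).trans (hK allTwo)
  have hfi : ∀ m, Integrable f (μ m) := fun m =>
    Integrable.of_bound hf.measurable.aestronglyMeasurable K (ae_of_all _ hK)
  rw [Metric.tendsto_atTop']
  intro ε hε
  obtain ⟨s, hs⟩ := exists_finset_forall_abs_sub_le hf allTwo (half_pos hε)
  -- Up to `ε / 2`, `f` is controlled by the finitely many sites of `s`; a noncritical site there
  -- costs at most `2 * K`, and a union bound follows.
  have hpt : ∀ ζ, |f ζ - f allTwo| ≤
      ε / 2 + ∑ x ∈ s, {ζ : Config | ζ x ≠ high}.indicator (fun _ => 2 * K) ζ := by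
    intro ζ
    have hnn : ∀ x ∈ s, 0 ≤ {ζ : Config | ζ x ≠ high}.indicator (fun _ => 2 * K) ζ :=
      fun x _ => Set.indicator_nonneg (fun _ _ => by positivity) _
    by_cases hζ : ∀ x ∈ s, ζ x = high
    · exact (hs ζ hζ).trans (le_add_of_nonneg_right (Finset.sum_nonneg hnn))
    · push Not at hζ
      obtain ⟨x, hx, hne⟩ := hζ
      have h1 := Finset.single_le_sum hnn hx
      rw [Set.indicator_of_mem (show ζ ∈ {ζ : Config | ζ x ≠ high} from hne)] at h1
      have h2 := abs_sub (f ζ) (f allTwo)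
      linarith [hK ζ, hK allTwo]
  have hint : ∀ m, |∫ ζ, f ζ ∂(μ m) - f allTwo| ≤
      ε / 2 + ∑ x ∈ s, (μ m).real {ζ | ζ x ≠ high} * (2 * K) := by
    intro m
    have hi : ∀ x ∈ s, Integrable
        ({ζ : Config | ζ x ≠ high}.indicator (fun _ => 2 * K)) (μ m) := fun x _ =>
      (integrable_const _).indicator (measurableSet_ne_high x)
    calc |∫ ζ, f ζ ∂(μ m) - f allTwo| = |∫ ζ, (f ζ - f allTwo) ∂(μ m)| := by
          rw [integral_sub (hfi m) (integrable_const _)]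
          simp
      _ ≤ ∫ ζ, |f ζ - f allTwo| ∂(μ m) := abs_integral_le_integral_abs
      _ ≤ ∫ ζ, (ε / 2 + ∑ x ∈ s, {ζ : Config | ζ x ≠ high}.indicator (fun _ => 2 * K) ζ) ∂(μ m) :=
          integral_mono ((hfi m).sub (integrable_const _)).abs
            ((integrable_const _).add (integrable_finsetSum _ hi)) hpt
      _ = _ := by
          rw [integral_add (integrable_const _) (integrable_finsetSum _ hi),
            integral_finsetSum _ hi]
          congr 1
          · simp
          · exact Finset.sum_congr rfl fun x _ =>
              integral_indicator_const _ (measurableSet_ne_high x)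
  have hlim : Tendsto (fun m => ε / 2 + ∑ x ∈ s, (μ m).real {ζ | ζ x ≠ high} * (2 * K)) atTop
      (𝓝 (ε / 2)) := by
    simpa using (tendsto_finsetSum s fun x _ => (h x).mul_const (2 * K)).const_add (ε / 2)
  obtain ⟨M, hM⟩ := (hlim.eventually (gt_mem_nhds (half_lt_self hε))).exists_forall_of_atTop
  exact ⟨M, fun m hm => (hint m).trans_lt (hM m hm.le)⟩

theorem tendsto_finSemigroup_truncation_allTwo (n : ℕ) {t : ℝ} (ht : 0 ≤ t) {f : Config → ℝ}
    (hf : Continuous f) :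
    Tendsto (fun m : ℕ => finSemigroup n t f (truncation m allTwo)) atTop (𝓝 (f allTwo)) := by
  simp_rw [truncation_allTwo]
  have hp : ∀ m : ℕ, IsProbabilityMeasure
      (chainLaw (Finset.Icc (-(n : ℤ)) n) t (Finset.Icc (-(m : ℤ)) m)) := fun m =>
    isProbabilityMeasure_chainLaw _ ht ⟨0, by simp⟩
  refine tendsto_integral_of_tendsto_measure hp (fun x => ?_) hf
  have hlim : Tendsto (fun m : ℕ => 1 / (2 * (m : ℝ) + 1)) atTop (𝓝 0) :=
    tendsto_const_nhds.div_atTop (tendsto_atTop_add_const_right _ _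
      (tendsto_natCast_atTop_atTop.const_mul_atTop two_pos))
  refine squeeze_zero' (.of_forall fun m => measureReal_nonneg) ?_ hlim
  -- The initial interval must contain both the birth sites and `x`.
  filter_upwards [eventually_ge_atTop (max n x.natAbs)] with m hm
  have h := chainLaw_Icc_le (B := Finset.Icc (-(n : ℤ)) n) (m := m) (x := x)
    (Finset.Icc_subset_Icc (by omega) (by omega)) (by rw [Finset.mem_Icc]; omega) ht
  refine (ENNReal.toReal_mono (by simp) h).trans_eq ?_
  rw [ENNReal.toReal_div, ENNReal.toReal_add (by finiteness) (by finiteness)]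
  simp

theorem isTransitionLaw_dirac_allTwo {t : ℝ} (ht : 0 ≤ t) :
    IsTransitionLaw t allTwo (Measure.dirac allTwo) := by
  refine ⟨inferInstance, fun f hf _ => ?_⟩
  rw [integral_dirac]
  exact ⟨fun _ => f allTwo, fun n => tendsto_finSemigroup_truncation_allTwo n ht hf,
    tendsto_const_nhds⟩

/-- Needed because `sandpileLaw` is an arbitrary choice. The indicators of `ζ x = high` are
continuous and monotone; testing against them makes every site critical almost surely, and there are
countably many sites. -/
theorem IsTransitionLaw.eq_dirac_allTwo {t : ℝ} (ht : 0 ≤ t) {μ : Measure Config}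
    (h : IsTransitionLaw t allTwo μ) : μ = Measure.dirac allTwo := by
  obtain ⟨hp, h⟩ := h
  have hle : ∀ y : Set.Icc (1 : ℕ) 2, y ≤ high := fun y => y.2.2
  have hnull : ∀ x, ∀ᵐ ζ ∂μ, ζ x = high := by
    intro x
    set S : Set Config := {ζ | ζ x ≠ high}ᶜ with hSdef
    have hmS : MeasurableSet S := (measurableSet_ne_high x).compl
    have hmem : ∀ ζ, ζ ∈ S ↔ ζ x = high := fun ζ => by simp [hSdef]
    have hclopen : IsClopen S := by
      have : S = (fun ζ : Config => ζ x) ⁻¹' {high} := Set.ext hmem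
      rw [this]
      exact (isClopen_discrete _).preimage (continuous_apply x)
    have hcont : Continuous (S.indicator fun _ => (1 : ℝ)) :=
      hclopen.continuous_indicator continuous_const
    have hmono : Monotone (S.indicator fun _ => (1 : ℝ)) := by
      intro ζ ξ hζξ
      by_cases hζ : ζ ∈ S
      · have hξ : ξ ∈ S := (hmem ξ).2 (le_antisymm (hle _) ((hmem ζ).1 hζ ▸ hζξ x))
        rw [Set.indicator_of_mem hζ, Set.indicator_of_mem hξ]
      · rw [Set.indicator_of_notMem hζ]
        exact Set.indicator_nonneg (fun _ _ => zero_le_one) _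
    obtain ⟨g, hg, hlim⟩ := h _ hcont hmono
    have hg' : g = fun _ => 1 := funext fun n => by
      rw [tendsto_nhds_unique (hg n) (tendsto_finSemigroup_truncation_allTwo n ht hcont)]
      exact Set.indicator_of_mem ((hmem allTwo).2 rfl) _
    rw [hg', integral_indicator_const _ hmS] at hlim
    have h1 := tendsto_nhds_unique hlim tendsto_const_nhds
    rw [smul_eq_mul, mul_one] at h1
    have h2 : μ S = 1 := by
      rw [← ENNReal.toReal_eq_one_iff]
      exact h1
    filter_upwards [(prob_compl_eq_zero_iff hmS).2 h2 |> measure_eq_zero_iff_ae_notMem.1]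
      with ζ hζ
    exact (hmem ζ).1 (not_not.1 hζ)
  have hae : ∀ᵐ ζ ∂μ, ζ = allTwo := (ae_all_iff.2 hnull).mono fun ζ hζ => funext hζ
  calc μ = μ.map id := Measure.map_id.symm
    _ = μ.map fun _ => allTwo := Measure.map_congr hae
    _ = Measure.dirac allTwo := by rw [Measure.map_const, measure_univ, one_smul]

theorem sandpileLaw_allTwo {t : ℝ} (ht : 0 ≤ t) :
    sandpileLaw t allTwo = Measure.dirac allTwo := by
  have h : ∃ μ : Measure Config, IsTransitionLaw t allTwo μ :=
    ⟨_, isTransitionLaw_dirac_allTwo ht⟩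
  rw [sandpileLaw, dif_pos h]
  exact h.choose_spec.eq_dirac_allTwo ht

theorem isInvariant_dirac_allTwo : IsInvariant (Measure.dirac allTwo) := fun t ht => by
  -- Under the Dirac measure the kernel agrees almost everywhere with a constant one, so its
  -- measurability in `η` is not required.
  rw [Measure.bind_congr_right (ae_eq_dirac (sandpileLaw t)), sandpileLaw_allTwo ht]
  exact Measure.dirac_bind measurable_const allTwo

end Sandpile

theorem proposition5p1 :
    Sandpile.IsInvariant (Measure.dirac Sandpile.allTwo) ∧
    (∀ t : ℝ, 0 ≤ t →
      Sandpile.IsTransitionLaw t Sandpile.allTwo (Measure.dirac Sandpile.allTwo)) ∧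
    (∀ (n : ℕ) (t : ℝ), 0 ≤ t →
      IsProbabilityMeasure (Sandpile.avalancheLaw t (Finset.Icc (-(n : ℤ)) n)) ∧
      Sandpile.avalancheLaw t (Finset.Icc (-(n : ℤ)) n) {ζ | ζ 0 ≠ Sandpile.high} ≤
        1 / (2 * (n : ℝ≥0∞) + 1)) :=
  ⟨Sandpile.isInvariant_dirac_allTwo, fun _ ht => Sandpile.isTransitionLaw_dirac_allTwo ht,
    fun _ _ ht => ⟨Sandpile.isProbabilityMeasure_chainLaw _ ht ⟨0, by simp⟩,
      Sandpile.chainLaw_Icc_le (Finset.empty_subset _) (by simp) ht⟩⟩
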